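/- Let $\mathcal H$ and $\mathcal G$ be real Hilbert spaces, and write $\mathscr Q=\tfrac12\|\cdot\|^2$ on either space. For functions $f$ with values in $[-\infty,+\infty]$ on a real Hilbert space, let $f^*(u)=\sup_{x}\big(\langle x,u\rangle-f(x)\big)$ be the Legendre conjugate, let ${}^{\gamma}\!f(x)=\inf_{y}\big(f(y)+\tfrac1\gamma\mathscr Q(x-y)\big)$ be the Moreau envelope of index $\gamma\in(0,+\infty)$, and set $\operatorname{dom} f=\{x : f(x)<+\infty\}$. The function $f$ is proper if $\operatorname{dom}f\neq\varnothing$ and $f$ never takes the value $-\infty$. For a bounded linear operator $A$, the infimal postcomposition of $f$ by $A$ is $(A\triangleright f)(y)=\inf_{Ax=y}f(x)$ (with $\inf\varnothing=+\infty$); it is called exact if, for every $y\in A(\operatorname{dom} f)$, there exists $x$ with $Ax=y$ and $(A\triangleright f)(y)=f(x)\in(-\infty,+\infty]$. Let $L\colon\mathcal H\to\mathcal G$ be a bounded linear operator, with adjoint $L^*$, such that $0<\|L\|\le 1$, let $g\colon\mathcal G\to(-\infty,+\infty]$ be a proper function which admits a continuous affine minorant, and let $\gamma\in(0,+\infty)$.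 For every $h\colon\mathcal G\to[-\infty,+\infty]$ and $\rho\in(0,+\infty)$, define the proximal composition and the proximal cocomposition of $h$ and $L$ with parameter $\rho$ by $$ L\overset{\rho}{\diamond}h=\Big({}^{1/\rho}(h^*)\circ L\Big)^*-\frac1\rho\mathscr Q , \qquad L\overset{\rho}{\blacklozenge}h=\Big(L\overset{1/\rho}{\diamond}h^*\Big)^* . $$ Then the following hold, all relations being pointwise on $\mathcal H$: (i) $L^*\triangleright g^{**}\le L\overset{\gamma}{\diamond}g$. (ii) ${}^{\gamma}(g^{**})\circ L\le L\overset{\gamma}{\blacklozenge}g\le g^{**}\circ L$. (iii) $L\overset{\gamma}{\blacklozenge}g\le L\overset{\gamma}{\diamond}g$. (iv) If $L$ is an isometry ($L^*\circ L=\mathrm{Id}_{\mathcal H}$), then $L\overset{\gamma}{\diamond}g=L\overset{\gamma}{\blacklozenge}g$. (v) If $L$ is a coisometry ($L\circ L^*=\mathrm{Id}_{\mathcal G}$), then $L\overset{\gamma}{\diamond}g=L^*\triangleright g^{**}$, this infimal postcomposition is exact, and $L\overset{\gamma}{\blacklozenge}g=g^{**}\circ L$. (vi) If $L$ is invertible with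 $L^{-1}=L^*$, then $L\overset{\gamma}{\diamond}g=L^*\triangleright g^{**}=g^{**}\circ L=L\overset{\gamma}{\blacklozenge}g$, and the infimal postcomposition is exact. -/

import Mathlib

noncomputable section

namespace ProxComp

variable {E F : Type*} [NormedAddCommGroup E] [InnerProductSpace ℝ E]
  [NormedAddCommGroup F] [InnerProductSpace ℝ F]

/-- The quadratic kernel `Q = ‖·‖² / 2`. -/
def quad (x : E) : ℝ := ‖x‖ ^ 2 / 2

/-- The Legendre conjugate `f* : u ↦ sup_x (⟨x, u⟩ - f x)` of an extended-real-valued function.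
The first term is a real number, so the difference is never of the form `∞ - ∞`. -/
def conjugate (f : E → EReal) : E → EReal :=
  fun u => ⨆ x : E, ((inner ℝ x u : ℝ) : EReal) - f x

/-- The Moreau envelope `x ↦ inf_y (f y + Q (x - y) / γ)` of index `γ`. -/
def moreauEnvelope (f : E → EReal) (γ : ℝ) : E → EReal :=
  fun x => ⨅ y : E, f y + ((1 / γ * quad (x - y) : ℝ) : EReal)

/-- The effective domain `{x | f x < +∞}`. -/
def effDomain (f : E → EReal) : Set E := {x | f x < ⊤}

/-- A function is proper if its domain is nonempty and it never takes the value `-∞`. -/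
def IsProper (f : E → EReal) : Prop := (effDomain f).Nonempty ∧ ∀ x, f x ≠ ⊥

/-- The set of continuous affine minorants of `f`. -/
def contAffineMinorants (f : E → EReal) : Set (E →ᴬ[ℝ] ℝ) := {h | ∀ x, ((h x : ℝ) : EReal) ≤ f x}

/-- The infimal postcomposition `A ▷ f : y ↦ inf {f x | A x = y}` of `f` by `A`. -/
def infPostcomp (A : E →L[ℝ] F) (f : E → EReal) : F → EReal :=
  fun y => ⨅ (x : E) (_ : A x = y), f x

/-- The infimal postcomposition `A ▷ f` is exact: at every point of `A (dom f)` the infimum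
is attained and is not `-∞`. -/
def ExactInfPostcomp (A : E →L[ℝ] F) (f : E → EReal) : Prop :=
  ∀ y ∈ A '' effDomain f, ∃ x : E, A x = y ∧ infPostcomp A f y = f x ∧ f x ≠ ⊥

/-- The proximal composition of `g` and `L` with parameter `γ`: the conjugate of
`(Moreau envelope of g* of index 1/γ) ∘ L`, minus `Q / γ`. -/
def proxComp (L : E →L[ℝ] F) (γ : ℝ) (g : F → EReal) : E → EReal :=
  fun x => conjugate (moreauEnvelope (conjugate g) (1 / γ) ∘ L) x
    - ((1 / γ * quad x : ℝ) : EReal)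

/-- The proximal cocomposition of `g` and `L` with parameter `γ`: the conjugate of the
proximal composition of `g*` and `L` with parameter `1/γ`. -/
def proxCocomp (L : E →L[ℝ] F) (γ : ℝ) (g : F → EReal) : E → EReal :=
  conjugate (proxComp L (1 / γ) (conjugate g))

end ProxComp

end

noncomputable section

namespace ProxComp

variable {E F : Type*} [NormedAddCommGroup E] [NormedAddCommGroup F]

/-! Everything follows from one formula: the proximal composition at `x` is the minimum, over `L* y
= x`, of `g** y + (Q y - Q x) / γ`, the value being `+∞` when no such `y` exists. The upper bound
(`proxComp_adjoint_le`) is Young's inequality. The lower bound with attainment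
(`exists_adjoint_eq_of_proxComp_le`) needs Hahn–Banach: the envelope of `g*` is a continuous convex
function, so an affine minorant of it along `L` lifts to one on all of `G`. Applied to `g*`, with
`g*** = g*`, the formula also controls the cocomposition. As `‖L*‖ ≤ 1`, the correction `Q y - Q (L*
y)` is nonnegative; it vanishes for coisometries. Extended-real inequalities are tested against real
upper bounds, so all algebra is in `ℝ`. -/

theorem coe_le_iff_forall_le_coe {a : ℝ} {z : EReal} :
    (a : EReal) ≤ z ↔ ∀ s : ℝ, z ≤ s → a ≤ s := by
  refine ⟨fun h s hs => EReal.coe_le_coe_iff.1 (h.trans hs), fun h => ?_⟩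
  exact EReal.le_of_forall_lt_iff_le.1 fun s hs => EReal.coe_le_coe_iff.2 (h s hs.le)

theorem le_of_forall_le_coe {x y : EReal} (h : ∀ r : ℝ, y ≤ r → x ≤ r) : x ≤ y :=
  EReal.le_of_forall_lt_iff_le.1 fun s hs => h s hs.le

theorem coe_sub_le_coe_iff {a r : ℝ} {z : EReal} :
    (a : EReal) - z ≤ r ↔ ((a - r : ℝ) : EReal) ≤ z := by
  rw [EReal.sub_le_iff_le_add (.inr (EReal.coe_ne_top _)) (.inr (EReal.coe_ne_bot _)),
    EReal.coe_sub, EReal.sub_le_iff_le_add (.inl (EReal.coe_ne_bot _))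
    (.inl (EReal.coe_ne_top _)), add_comm]

theorem quad_nonneg (x : E) : 0 ≤ quad x := by unfold quad; positivity

theorem coe_le_moreauEnvelope_iff {f : E → EReal} {γ a : ℝ} {x : E} :
    (a : EReal) ≤ moreauEnvelope f γ x ↔
      ∀ y (s : ℝ), f y ≤ s → a ≤ s + 1 / γ * quad (x - y) := by
  simp only [moreauEnvelope, le_iInf_iff]
  refine forall_congr' fun y => ?_
  rw [← EReal.sub_le_iff_le_add (.inl (EReal.coe_ne_bot _)) (.inl (EReal.coe_ne_top _)),
    ← EReal.coe_sub, coe_le_iff_forall_le_coe]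
  simp only [sub_le_iff_le_add]

theorem moreauEnvelope_lt_coe_iff {f : E → EReal} {γ a : ℝ} {x : E} :
    moreauEnvelope f γ x < a ↔
      ∃ y, ∃ s : ℝ, f y ≤ s ∧ s + 1 / γ * quad (x - y) < a := by
  rw [← not_iff_not, not_lt, coe_le_moreauEnvelope_iff]
  push Not
  rfl

theorem moreauEnvelope_le_coe {f : E → EReal} {γ s : ℝ} {y : E} (h : f y ≤ s) (x : E) :
    moreauEnvelope f γ x ≤ ((s + 1 / γ * quad (x - y) : ℝ) : EReal) :=
  (iInf_le _ y).trans (by rw [EReal.coe_add]; gcongr)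

variable [InnerProductSpace ℝ E] [InnerProductSpace ℝ F]

/-! ### Quadratic identities and Legendre conjugation. -/

theorem quad_sub (x y : E) : quad (x - y) = quad x - inner ℝ x y + quad y := by
  simp only [quad, norm_sub_sq_real]; ring

theorem quad_smul (a : ℝ) (x : E) : quad (a • x) = a ^ 2 * quad x := by
  simp only [quad, norm_smul, mul_pow, Real.norm_eq_abs, sq_abs]; ring

theorem inner_self_eq_two_mul_quad (x : E) : inner ℝ x x = 2 * quad x := by
  simp only [quad, real_inner_self_eq_norm_sq]; ring

theorem quad_convex_combination_le {a b : ℝ} (ha : 0 ≤ a) (hb : 0 ≤ b) (hab : a + b = 1)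
    (x y : E) : quad (a • x + b • y) ≤ a * quad x + b * quad y := by
  have h : quad (a • x + b • y) = a * quad x + b * quad y - a * b * quad (x - y) := by
    obtain rfl : b = 1 - a := by linarith
    rw [quad_sub]
    simp only [quad, norm_add_sq_real, norm_smul, mul_pow, Real.norm_eq_abs, sq_abs,
      real_inner_smul_left, real_inner_smul_right]
    ring
  have := mul_nonneg (mul_nonneg ha hb) (quad_nonneg (x - y))
  linarith

theorem conjugate_le_coe_iff {f : E → EReal} {u : E} {r : ℝ} :
    conjugate f u ≤ r ↔ ∀ x, ((inner ℝ x u - r : ℝ) : EReal) ≤ f x := by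
  simp only [conjugate, iSup_le_iff, coe_sub_le_coe_iff]

/-- The Fenchel–Young inequality. -/
theorem inner_le_add_of_conjugate_le {f : E → EReal} {u x : E} {r s : ℝ}
    (hu : conjugate f u ≤ r) (hx : f x ≤ s) : inner ℝ x u ≤ r + s := by
  have := coe_le_iff_forall_le_coe.1 (conjugate_le_coe_iff.1 hu x) s hx
  linarith

theorem conjugate_le_coe_of_forall {f : E → EReal} {u : E} {r : ℝ}
    (h : ∀ x (s : ℝ), f x ≤ s → inner ℝ x u ≤ r + s) : conjugate f u ≤ r :=
  conjugate_le_coe_iff.2 fun x => coe_le_iff_forall_le_coe.2 fun s hs => by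
    linarith [h x s hs]

theorem biconjugate_le (f : E → EReal) : conjugate (conjugate f) ≤ f := fun x =>
  le_of_forall_le_coe fun r hr => conjugate_le_coe_of_forall fun u s hu => by
    rw [real_inner_comm]; linarith [inner_le_add_of_conjugate_le hu hr]

theorem conjugate_antitone {f g : E → EReal} (h : f ≤ g) : conjugate g ≤ conjugate f :=
  fun _ => iSup_mono fun x => EReal.sub_le_sub le_rfl (h x)

theorem conjugate_triconjugate (f : E → EReal) :
    conjugate (conjugate (conjugate f)) = conjugate f :=
  le_antisymm (biconjugate_le _) (conjugate_antitone (biconjugate_le f))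

/-! ### Regularity of the envelope and Hahn–Banach. -/

/-- The envelope of a conjugate with both `f` and `f*` finite somewhere is a real-valued continuous
convex function. -/
theorem exists_moreauEnvelope_conjugate_eq_coe {f : E → EReal} {γ r₀ s₀ : ℝ} (hγ : 0 < γ)
    {x₀ z₀ : E} (hx₀ : f x₀ ≤ r₀) (hz₀ : conjugate f z₀ ≤ s₀) :
    ∃ e : E → ℝ, (∀ x, moreauEnvelope (conjugate f) γ x = e x) ∧
      ConvexOn ℝ Set.univ e ∧ Continuous e := by
  have hup : ∀ x, moreauEnvelope (conjugate f) γ x ≤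
      ((s₀ + 1 / γ * quad (x - z₀) : ℝ) : EReal) := moreauEnvelope_le_coe hz₀
  have hlow : ∀ x, ((inner ℝ x₀ x - r₀ - γ * quad x₀ : ℝ) : EReal) ≤
      moreauEnvelope (conjugate f) γ x := by
    refine fun x => coe_le_moreauEnvelope_iff.2 fun z s hs => ?_
    have h1 := inner_le_add_of_conjugate_le hs hx₀
    -- Completing the square removes the dependence on `z`.
    have h2 := quad_nonneg ((x - z) - γ • x₀)
    rw [quad_sub, quad_smul, real_inner_smul_right, real_inner_comm, inner_sub_right] at h2
    have h3 : 1 / γ * (quad (x - z) - γ * (inner ℝ x₀ x - inner ℝ x₀ z) + γ ^ 2 * quad x₀) =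
        1 / γ * quad (x - z) - (inner ℝ x₀ x - inner ℝ x₀ z) + γ * quad x₀ := by
      field_simp
    have h4 := mul_nonneg (one_div_pos.2 hγ).le h2
    rw [h3] at h4
    linarith
  have he : ∀ x, moreauEnvelope (conjugate f) γ x =
      ((moreauEnvelope (conjugate f) γ x).toReal : ℝ) := fun x =>
    (EReal.coe_toReal ((hup x).trans_lt (EReal.coe_lt_top _)).ne
      ((EReal.bot_lt_coe _).trans_le (hlow x)).ne').symm
  generalize hedef : (fun x => (moreauEnvelope (conjugate f) γ x).toReal) = e
  replace he : ∀ x, moreauEnvelope (conjugate f) γ x = e x := fun x => by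
    rw [he, ← hedef]
  refine ⟨e, he, ?_⟩
  have hconv : ConvexOn ℝ Set.univ e := by
    refine ⟨convex_univ, fun x _ y _ a b ha hb hab => ?_⟩
    simp only [smul_eq_mul]
    -- Near-minimizers suffice, so attainment in the envelope is not needed.
    refine le_of_forall_pos_lt_add fun ε hε => ?_
    have hlt : ∀ x, moreauEnvelope (conjugate f) γ x < ((e x + ε : ℝ) : EReal) := fun x => by
      rw [he]; exact EReal.coe_lt_coe_iff.2 (by linarith)
    obtain ⟨z, s, hs, hzs⟩ := moreauEnvelope_lt_coe_iff.1 (hlt x)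
    obtain ⟨w, t, ht, hwt⟩ := moreauEnvelope_lt_coe_iff.1 (hlt y)
    rw [← EReal.coe_lt_coe_iff, ← he, moreauEnvelope_lt_coe_iff]
    refine ⟨a • z + b • w, a * s + b * t, conjugate_le_coe_of_forall fun v c hc => ?_, ?_⟩
    · have h1 := inner_le_add_of_conjugate_le hs hc
      have h2 := inner_le_add_of_conjugate_le ht hc
      rw [inner_add_right, real_inner_smul_right, real_inner_smul_right]
      obtain rfl : b = 1 - a := by linarith
      nlinarith
    · have h1 : a • x + b • y - (a • z + b • w) = a • (x - z) + b • (y - w) := by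
        simp only [smul_sub]; abel
      have h2 := mul_le_mul_of_nonneg_left
        (quad_convex_combination_le ha hb hab (x - z) (y - w)) (one_div_pos.2 hγ).le
      rw [h1]
      have h3 : a * (s + 1 / γ * quad (x - z)) + b * (t + 1 / γ * quad (y - w)) <
          a * (e x + ε) + b * (e y + ε) := by
        rcases ha.eq_or_lt with rfl | ha'
        · obtain rfl : b = 1 := by linarith
          linarith
        · exact add_lt_add_of_lt_of_le (mul_lt_mul_of_pos_left hzs ha')
            (mul_le_mul_of_nonneg_left hwt.le hb)
      have h4 : a * (e x + ε) + b * (e y + ε) = a * e x + b * e y + ε := by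
        obtain rfl : b = 1 - a := by linarith
        ring
      linarith
  refine ⟨hconv, continuousOn_univ.1 ?_⟩
  -- A convex function bounded above near one point is continuous; `hup` gives such a bound on the
  -- unit ball at `z₀`.
  have htfae := hconv.continuousOn_tfae isOpen_univ Set.univ_nonempty
  refine (htfae.out 3 1 :
    (∃ x₀ ∈ Set.univ, (nhds x₀).IsBoundedUnder (· ≤ ·) e) ↔ ContinuousOn e Set.univ).1
    ⟨z₀, trivial, s₀ + 1 / γ * 1, ?_⟩
  rw [Filter.eventually_map]
  filter_upwards [Metric.ball_mem_nhds z₀ one_pos] with x hx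
  have h1 := hup x
  rw [he, EReal.coe_le_coe_iff] at h1
  refine h1.trans (add_le_add le_rfl
    (mul_le_mul_of_nonneg_left ?_ (one_div_pos.2 hγ).le))
  rw [mem_ball_iff_norm] at hx
  unfold quad
  nlinarith [norm_nonneg (x - z₀)]

/-- A continuous convex function minorized along the range of `L` by an affine function
has an affine minorant that extends it. -/
theorem exists_adjoint_eq_of_inner_sub_le [CompleteSpace E] [CompleteSpace F]
    {e : F → ℝ} (hconv : ConvexOn ℝ Set.univ e) (hcont : Continuous e) (L : E →L[ℝ] F)
    {x : E} {c : ℝ} (h : ∀ w, inner ℝ w x - c ≤ e (L w)) :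
    ∃ y, ContinuousLinearMap.adjoint L y = x ∧ ∀ z, inner ℝ z y - c ≤ e z := by
  have hS : Convex ℝ {p : F × ℝ | e p.1 < p.2} := by
    simpa using hconv.convex_strict_epigraph
  have hSo : IsOpen {p : F × ℝ | e p.1 < p.2} :=
    isOpen_lt (hcont.comp continuous_fst) continuous_snd
  have hT : Convex ℝ (Set.range fun w : E => ((L w, inner ℝ w x - c) : F × ℝ)) := by
    rintro _ ⟨v, rfl⟩ _ ⟨w, rfl⟩ a b _ _ hab
    refine ⟨a • v + b • w, ?_⟩
    obtain rfl : b = 1 - a := by linarith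
    simp only [map_add, map_smul, inner_add_left, real_inner_smul_left, Prod.smul_mk,
      Prod.mk_add_mk, smul_eq_mul, Prod.mk.injEq, true_and]
    ring
  have hdisj : Disjoint {p : F × ℝ | e p.1 < p.2}
      (Set.range fun w : E => ((L w, inner ℝ w x - c) : F × ℝ)) := by
    rw [Set.disjoint_left]
    rintro _ hp ⟨w, rfl⟩
    exact (h w).not_gt hp
  -- Separate the open strict epigraph from the graph of the minorant over the range of `L`.
  obtain ⟨φ, u, hφS, hφT⟩ := geometric_hahn_banach_open hS hSo hT hdisj
  set a : F := (InnerProductSpace.toDual ℝ F).symm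
    (φ.comp (ContinuousLinearMap.inl ℝ F ℝ)) with ha
  set b : ℝ := φ (0, 1) with hb
  have hφ : ∀ z t, φ (z, t) = inner ℝ a z + b * t := fun z t => by
    have h1 : ((z, t) : F × ℝ) = (z, 0) + t • (0, 1) := by simp
    rw [h1, map_add, map_smul, ha, InnerProductSpace.toDual_symm_apply, smul_eq_mul, mul_comm t]
    rfl
  have hS' : ∀ z t, e z < t → inner ℝ a z + b * t < u := fun z t hzt => by
    rw [← hφ]; exact hφS _ hzt
  have hT' : ∀ w, u ≤ inner ℝ a (L w) + b * (inner ℝ w x - c) := fun w => by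
    rw [← hφ]; exact hφT _ ⟨w, rfl⟩
  have hu : u ≤ - (b * c) := by simpa using hT' 0
  -- The hyperplane is not vertical: above the origin it separates `e 0 + 1` from `-c`.
  have hbneg : b < 0 := by
    have h1 := hS' 0 (e 0 + 1) (by linarith)
    have h2 : -c ≤ e 0 := by simpa using h 0
    rw [inner_zero_right] at h1
    nlinarith
  -- An affine function of `w` that is bounded below has zero linear part.
  have hv : ContinuousLinearMap.adjoint L a + b • x = 0 := by
    set v := ContinuousLinearMap.adjoint L a + b • x with hvdef
    by_contra hne
    have hpos : 0 < inner ℝ v v := real_inner_self_pos.2 hne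
    have h1 : ∀ t : ℝ, u + b * c ≤ t * inner ℝ v v := fun t => by
      have h2 := hT' (t • v)
      have h3 : inner ℝ a (L (t • v)) + b * inner ℝ (t • v) x = t * inner ℝ v v := by
        rw [← ContinuousLinearMap.adjoint_inner_left, real_inner_smul_right,
          real_inner_smul_left]
        conv_rhs => rw [hvdef, inner_add_left, ← hvdef, real_inner_smul_left]
        rw [real_inner_comm x v]; ring
      linarith
    have h4 := h1 ((u + b * c - 1) / inner ℝ v v)
    rw [div_mul_cancel₀ _ hpos.ne'] at h4
    linarith
  refine ⟨(-b⁻¹) • a, ?_, fun z => le_of_forall_gt_imp_ge_of_dense fun t ht => ?_⟩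
  · rw [map_smul, eq_neg_of_add_eq_zero_left hv, smul_neg, neg_smul, neg_neg,
      smul_smul, inv_mul_cancel₀ hbneg.ne, one_smul]
  · have h1 := hS' z t ht
    rw [real_inner_smul_right, real_inner_comm]
    have h2 : inner ℝ a z < b * (-t - c) := by linarith
    have h3 : -b⁻¹ * inner ℝ a z < -b⁻¹ * (b * (-t - c)) :=
      mul_lt_mul_of_pos_left h2 (by simpa using hbneg)
    have h4 : -b⁻¹ * (b * (-t - c)) = t + c := by field_simp [hbneg.ne]; ring
    linarith

/-- A continuous convex function is subdifferentiable. -/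
theorem exists_subgradient [CompleteSpace F] {e : F → ℝ} (hconv : ConvexOn ℝ Set.univ e)
    (hcont : Continuous e) (w : F) : ∃ y, ∀ z, e w + inner ℝ (z - w) y ≤ e z := by
  have hconv' : ConvexOn ℝ Set.univ fun z => e (w + z) := by
    simpa [Function.comp_def] using hconv.translate_right w
  -- For the zero operator only the value at the translated origin is prescribed.
  obtain ⟨y, -, hy⟩ := exists_adjoint_eq_of_inner_sub_le hconv'
    (hcont.comp (continuous_const.add continuous_id)) (0 : F →L[ℝ] F) (x := 0) (c := -e w)
    (by simp)
  refine ⟨y, fun z => ?_⟩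
  have := hy (z - w)
  rw [add_sub_cancel] at this
  linarith

/-! ### Proximal composition. -/

section

variable {H G : Type*}
  [NormedAddCommGroup H] [InnerProductSpace ℝ H]
  [NormedAddCommGroup G] [InnerProductSpace ℝ G]

theorem proxComp_le_coe_iff {L : H →L[ℝ] G} {γ c : ℝ} {f : G → EReal} {x : H} :
    proxComp L γ f x ≤ c ↔
      ∀ w z (s : ℝ), conjugate f z ≤ s →
        inner ℝ w x - (c + 1 / γ * quad x) ≤ s + γ * quad (L w - z) := by
  rw [proxComp, EReal.sub_le_iff_le_add (.inl (EReal.coe_ne_bot _)) (.inl (EReal.coe_ne_top _)),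
    ← EReal.coe_add, conjugate_le_coe_iff]
  simp only [Function.comp_apply, coe_le_moreauEnvelope_iff, one_div_one_div]

theorem proxCocomp_le_coe_iff {L : H →L[ℝ] G} {γ c : ℝ} {f : G → EReal} {x : H} :
    proxCocomp L γ f x ≤ c ↔
      ∀ u (t : ℝ), proxComp L (1 / γ) (conjugate f) u ≤ t → inner ℝ u x ≤ c + t := by
  rw [proxCocomp, conjugate_le_coe_iff]
  simp only [coe_le_iff_forall_le_coe, sub_le_iff_le_add, add_comm c]

theorem infPostcomp_apply_le (A : G →L[ℝ] H) (f : G → EReal) (y : G) :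
    infPostcomp A f (A y) ≤ f y := iInf_le_of_le y (iInf_le _ rfl)

theorem infPostcomp_apply_of_injective {A : G →L[ℝ] H} (hA : Function.Injective A)
    (f : G → EReal) (y : G) : infPostcomp A f (A y) = f y :=
  le_antisymm (infPostcomp_apply_le A f y) (le_iInf₂ fun z hz => by rw [hA hz])

theorem exactInfPostcomp_of_injective {A : G →L[ℝ] H} (hA : Function.Injective A)
    {f : G → EReal} (hf : ∀ y, f y ≠ ⊥) : ExactInfPostcomp A f := by
  rintro _ ⟨y, -, rfl⟩
  exact ⟨y, rfl, infPostcomp_apply_of_injective hA f y, hf y⟩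

theorem conjugate_ne_bot {f : G → EReal} {x₀ : G} {r₀ : ℝ} (hx₀ : f x₀ ≤ r₀) (u : G) :
    conjugate f u ≠ ⊥ := fun h => by
  have := inner_le_add_of_conjugate_le (r := inner ℝ x₀ u - r₀ - 1) (h.trans_le bot_le) hx₀
  linarith

variable [CompleteSpace H] [CompleteSpace G]

theorem proxComp_adjoint_le {L : H →L[ℝ] G} {γ : ℝ} (hγ : 0 < γ) {f : G → EReal} {y : G} {r : ℝ}
    (hr : conjugate (conjugate f) y ≤ r) :
    proxComp L γ f (ContinuousLinearMap.adjoint L y) ≤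
      ((r + 1 / γ * (quad y - quad (ContinuousLinearMap.adjoint L y)) : ℝ) : EReal) := by
  refine proxComp_le_coe_iff.2 fun w z s hs => ?_
  have h1 := inner_le_add_of_conjugate_le hr hs
  have h2 := quad_nonneg (γ • (L w - z) - y)
  rw [quad_sub, quad_smul, real_inner_smul_left, inner_sub_left] at h2
  have h3 := mul_nonneg (one_div_pos.2 hγ).le h2
  have h4 : 1 / γ * (γ ^ 2 * quad (L w - z) - γ * (inner ℝ (L w) y - inner ℝ z y) + quad y) =
      γ * quad (L w - z) - (inner ℝ (L w) y - inner ℝ z y) + 1 / γ * quad y := by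
    field_simp
  rw [h4] at h3
  rw [ContinuousLinearMap.adjoint_inner_right]
  linarith

theorem exists_adjoint_eq_of_proxComp_le {L : H →L[ℝ] G} {γ c r₀ s₀ : ℝ} (hγ : 0 < γ)
    {f : G → EReal} {x₀ z₀ : G} (hx₀ : f x₀ ≤ r₀) (hz₀ : conjugate f z₀ ≤ s₀) {x : H}
    (hc : proxComp L γ f x ≤ c) :
    ∃ y, ContinuousLinearMap.adjoint L y = x ∧
      conjugate (conjugate f) y ≤ ((c - 1 / γ * (quad y - quad x) : ℝ) : EReal) := by
  obtain ⟨e, he, hconv, hcont⟩ :=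
    exists_moreauEnvelope_conjugate_eq_coe (one_div_pos.2 hγ) hx₀ hz₀
  obtain ⟨y, hy, hye⟩ := exists_adjoint_eq_of_inner_sub_le hconv hcont L (x := x)
    (c := c + 1 / γ * quad x) fun w => by
      rw [← EReal.coe_le_coe_iff, ← he, coe_le_moreauEnvelope_iff, one_div_one_div]
      exact proxComp_le_coe_iff.1 hc w
  refine ⟨y, hy, conjugate_le_coe_of_forall fun z s hs => ?_⟩
  -- The shift `y / γ` maximizes `⟨d, y⟩ - γ Q d` over `d`, giving the sharp constant `Q y / γ`.
  have h1 := hye (z + (1 / γ) • y)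
  have h2 := moreauEnvelope_le_coe (γ := 1 / γ) hs (z + (1 / γ) • y)
  rw [he, EReal.coe_le_coe_iff, add_sub_cancel_left, quad_smul, one_div_one_div] at h2
  rw [inner_add_left, real_inner_smul_left, inner_self_eq_two_mul_quad] at h1
  have h3 : γ * ((1 / γ) ^ 2 * quad y) = 1 / γ * quad y := by field_simp
  rw [h3] at h2
  linarith

theorem quad_adjoint_le {L : H →L[ℝ] G} (hL : ‖L‖ ≤ 1) (y : G) :
    quad (ContinuousLinearMap.adjoint L y) ≤ quad y := by
  have h : ‖ContinuousLinearMap.adjoint L y‖ ≤ 1 * ‖y‖ :=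
    ContinuousLinearMap.le_of_opNorm_le _ (by rwa [LinearIsometryEquiv.norm_map]) y
  rw [one_mul] at h
  unfold quad
  gcongr

theorem infPostcomp_le_proxComp {L : H →L[ℝ] G} (hL : ‖L‖ ≤ 1) {γ r₀ s₀ : ℝ} (hγ : 0 < γ)
    {f : G → EReal} {x₀ z₀ : G} (hx₀ : f x₀ ≤ r₀) (hz₀ : conjugate f z₀ ≤ s₀) :
    infPostcomp (ContinuousLinearMap.adjoint L) (conjugate (conjugate f)) ≤ proxComp L γ f := by
  refine fun x => le_of_forall_le_coe fun c hc => ?_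
  obtain ⟨y, rfl, hy⟩ := exists_adjoint_eq_of_proxComp_le hγ hx₀ hz₀ hc
  refine (infPostcomp_apply_le _ _ y).trans (hy.trans (EReal.coe_le_coe_iff.2 ?_))
  have := mul_nonneg (one_div_pos.2 hγ).le (sub_nonneg.2 (quad_adjoint_le hL y))
  linarith

/-! ### Proximal cocomposition. -/

theorem proxComp_conjugate_adjoint_le {L : H →L[ℝ] G} {γ : ℝ} (hγ : 0 < γ) {f : G → EReal}
    {z : G} {s : ℝ} (hs : conjugate f z ≤ s) :
    proxComp L (1 / γ) (conjugate f) (ContinuousLinearMap.adjoint L z) ≤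
      ((s + γ * (quad z - quad (ContinuousLinearMap.adjoint L z)) : ℝ) : EReal) := by
  rw [← conjugate_triconjugate] at hs
  simpa only [one_div_one_div] using proxComp_adjoint_le (L := L) (one_div_pos.2 hγ) hs

theorem exists_adjoint_eq_of_proxComp_conjugate_le {L : H →L[ℝ] G} {γ c r₀ s₀ : ℝ} (hγ : 0 < γ)
    {f : G → EReal} {x₀ z₀ : G} (hx₀ : f x₀ ≤ r₀) (hz₀ : conjugate f z₀ ≤ s₀) {u : H}
    (hc : proxComp L (1 / γ) (conjugate f) u ≤ c) :
    ∃ v, ContinuousLinearMap.adjoint L v = u ∧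
      conjugate f v ≤ ((c - γ * (quad v - quad u) : ℝ) : EReal) := by
  simpa only [one_div_one_div, conjugate_triconjugate] using
    exists_adjoint_eq_of_proxComp_le (one_div_pos.2 hγ) hz₀ ((biconjugate_le f x₀).trans hx₀) hc

/-- A subgradient `y` of the envelope at `L x` makes `L* y` a test point for the conjugate defining
the cocomposition. -/
theorem moreauEnvelope_comp_le_proxCocomp {L : H →L[ℝ] G} {γ r₀ s₀ : ℝ} (hγ : 0 < γ)
    {f : G → EReal} {x₀ z₀ : G} (hx₀ : f x₀ ≤ r₀) (hz₀ : conjugate f z₀ ≤ s₀) :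
    moreauEnvelope (conjugate (conjugate f)) γ ∘ L ≤ proxCocomp L γ f := by
  refine fun x => le_of_forall_le_coe fun c hc => ?_
  obtain ⟨e, he, hconv, hcont⟩ :=
    exists_moreauEnvelope_conjugate_eq_coe hγ hz₀ ((biconjugate_le f x₀).trans hx₀)
  obtain ⟨y, hy⟩ := exists_subgradient hconv hcont (L x)
  rw [Function.comp_apply, he, EReal.coe_le_coe_iff]
  set u := ContinuousLinearMap.adjoint L y with hu
  have h : proxComp L (1 / γ) (conjugate f) u ≤ ((inner ℝ x u - e (L x) : ℝ) : EReal) := by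
    refine proxComp_le_coe_iff.2 fun w z s hs => ?_
    have h1 := moreauEnvelope_le_coe (γ := γ) hs (L w)
    rw [he, EReal.coe_le_coe_iff] at h1
    have h2 := hy (L w)
    rw [← map_sub, ← ContinuousLinearMap.adjoint_inner_right, ← hu, inner_sub_left] at h2
    have h3 := mul_nonneg hγ.le (quad_nonneg u)
    linarith
  have h1 := proxCocomp_le_coe_iff.1 hc u _ h
  rw [real_inner_comm] at h1
  linarith

theorem proxCocomp_le_biconjugate_comp {L : H →L[ℝ] G} (hL : ‖L‖ ≤ 1) {γ r₀ s₀ : ℝ}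
    (hγ : 0 < γ) {f : G → EReal} {x₀ z₀ : G} (hx₀ : f x₀ ≤ r₀) (hz₀ : conjugate f z₀ ≤ s₀) :
    proxCocomp L γ f ≤ conjugate (conjugate f) ∘ L := by
  refine fun x => le_of_forall_le_coe fun r hr => proxCocomp_le_coe_iff.2 fun u t ht => ?_
  obtain ⟨v, rfl, hv⟩ := exists_adjoint_eq_of_proxComp_conjugate_le hγ hx₀ hz₀ ht
  have h1 := inner_le_add_of_conjugate_le hr hv
  have h2 := mul_nonneg hγ.le (sub_nonneg.2 (quad_adjoint_le hL v))
  rw [ContinuousLinearMap.adjoint_inner_left]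
  linarith

theorem proxCocomp_le_proxComp {L : H →L[ℝ] G} (hL : ‖L‖ ≤ 1) {γ r₀ s₀ : ℝ}
    (hγ : 0 < γ) {f : G → EReal} {x₀ z₀ : G} (hx₀ : f x₀ ≤ r₀) (hz₀ : conjugate f z₀ ≤ s₀) :
    proxCocomp L γ f ≤ proxComp L γ f := by
  refine fun x => le_of_forall_le_coe fun c hc => proxCocomp_le_coe_iff.2 fun u t ht => ?_
  obtain ⟨y, rfl, hy⟩ := exists_adjoint_eq_of_proxComp_le hγ hx₀ hz₀ hc
  obtain ⟨v, rfl, hv⟩ := exists_adjoint_eq_of_proxComp_conjugate_le hγ hx₀ hz₀ ht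
  have h1 := inner_le_add_of_conjugate_le hy hv
  -- Contraction of `L*` at `y + γ v` produces both quadratic corrections and exactly the cross
  -- terms that turn `⟨v, y⟩` into `⟨L* v, L* y⟩`.
  have h2 := sub_nonneg.2 (quad_adjoint_le hL (y - (-γ) • v))
  rw [map_sub, map_smul, quad_sub, quad_sub, quad_smul, quad_smul, real_inner_smul_right,
    real_inner_smul_right, real_inner_comm, real_inner_comm (ContinuousLinearMap.adjoint L v)] at h2
  generalize ContinuousLinearMap.adjoint L y = x at *
  generalize ContinuousLinearMap.adjoint L v = u at *
  have h3 := mul_nonneg (one_div_pos.2 hγ).le h2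
  have h4 : 1 / γ * (quad y - -γ * inner ℝ v y + (-γ) ^ 2 * quad v -
      (quad x - -γ * inner ℝ u x + (-γ) ^ 2 * quad u)) =
      1 / γ * (quad y - quad x) + γ * (quad v - quad u) + inner ℝ v y - inner ℝ u x := by
    field_simp; ring
  rw [h4] at h3
  linarith

/-! ### Isometries and coisometries. -/

theorem proxComp_le_proxCocomp_of_isometry {L : H →L[ℝ] G} {γ : ℝ} (hγ : 0 < γ) (f : G → EReal)
    (hL : ContinuousLinearMap.adjoint L ∘L L = ContinuousLinearMap.id ℝ H) :
    proxComp L γ f ≤ proxCocomp L γ f := by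
  have hLL : ∀ x, ContinuousLinearMap.adjoint L (L x) = x := DFunLike.congr_fun hL
  refine fun x => le_of_forall_le_coe fun c hc => proxComp_le_coe_iff.2 fun w z s hs => ?_
  have h1 := proxCocomp_le_coe_iff.1 hc _ _ (proxComp_conjugate_adjoint_le hγ hs)
  have hq : quad (L w) = quad w := by
    have h := inner_self_eq_two_mul_quad (L w)
    rw [← ContinuousLinearMap.adjoint_inner_left, hLL, inner_self_eq_two_mul_quad] at h
    linarith
  -- For an isometry, `Q (L w - z) = Q (w - L* z) + Q z - Q (L* z)`; Young's inequality handles the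
  -- first term and `h1` the rest.
  have h2 := quad_nonneg (γ • (w - ContinuousLinearMap.adjoint L z) - x)
  rw [quad_sub, quad_smul, quad_sub, real_inner_smul_left, inner_sub_left,
    ContinuousLinearMap.adjoint_inner_right] at h2
  have h3 := mul_nonneg (one_div_pos.2 hγ).le h2
  generalize ContinuousLinearMap.adjoint L z = u at *
  have h4 : 1 / γ * (γ ^ 2 * (quad w - inner ℝ (L w) z + quad u) -
      γ * (inner ℝ w x - inner ℝ u x) + quad x) =
      γ * (quad w - inner ℝ (L w) z + quad u) - (inner ℝ w x - inner ℝ u x) +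
        1 / γ * quad x := by
    field_simp
  rw [h4] at h3
  rw [quad_sub, hq]
  linarith

theorem quad_adjoint_eq_of_coisometry {L : H →L[ℝ] G}
    (hL : L ∘L ContinuousLinearMap.adjoint L = ContinuousLinearMap.id ℝ G) (y : G) :
    quad (ContinuousLinearMap.adjoint L y) = quad y := by
  have hLL : ∀ x, L (ContinuousLinearMap.adjoint L x) = x := DFunLike.congr_fun hL
  have h := inner_self_eq_two_mul_quad (ContinuousLinearMap.adjoint L y)
  rw [ContinuousLinearMap.adjoint_inner_left, hLL, inner_self_eq_two_mul_quad] at h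
  linarith

theorem proxComp_le_infPostcomp_of_coisometry {L : H →L[ℝ] G} {γ : ℝ} (hγ : 0 < γ)
    (f : G → EReal) (hL : L ∘L ContinuousLinearMap.adjoint L = ContinuousLinearMap.id ℝ G) :
    proxComp L γ f ≤
      infPostcomp (ContinuousLinearMap.adjoint L) (conjugate (conjugate f)) := by
  refine fun x => le_iInf₂ fun y hy => le_of_forall_le_coe fun r hr => ?_
  subst hy
  simpa [quad_adjoint_eq_of_coisometry hL] using proxComp_adjoint_le (L := L) hγ hr

theorem biconjugate_comp_le_proxCocomp_of_coisometry {L : H →L[ℝ] G} {γ : ℝ} (hγ : 0 < γ)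
    (f : G → EReal) (hL : L ∘L ContinuousLinearMap.adjoint L = ContinuousLinearMap.id ℝ G) :
    conjugate (conjugate f) ∘ L ≤ proxCocomp L γ f := by
  refine fun x => le_of_forall_le_coe fun c hc => conjugate_le_coe_of_forall fun v s hs => ?_
  have h := proxCocomp_le_coe_iff.1 hc _ _ (proxComp_conjugate_adjoint_le hγ hs)
  rwa [quad_adjoint_eq_of_coisometry hL, sub_self, mul_zero, add_zero,
    ContinuousLinearMap.adjoint_inner_left] at h

/-- The slope of the minorant, via Riesz, is a point where the conjugate is at most `-h 0`. -/
theorem exists_conjugate_le_of_contAffineMinorant {f : G → EReal} {h : G →ᴬ[ℝ] ℝ}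
    (hf : h ∈ contAffineMinorants f) : ∃ z, ∃ s : ℝ, conjugate f z ≤ s := by
  refine ⟨(InnerProductSpace.toDual ℝ G).symm h.contLinear, -h 0,
    conjugate_le_coe_iff.2 fun x => le_trans (le_of_eq ?_) (hf x)⟩
  have h1 := h.map_vadd 0 x
  simp only [vadd_eq_add, add_zero] at h1
  rw [real_inner_comm, InnerProductSpace.toDual_symm_apply, h1, sub_neg_eq_add]

end

end ProxComp

end

theorem mainTheorem7 {H G : Type*}
    [NormedAddCommGroup H] [InnerProductSpace ℝ H] [CompleteSpace H]
    [NormedAddCommGroup G] [InnerProductSpace ℝ G] [CompleteSpace G]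
    (L : H →L[ℝ] G) (hL0 : 0 < ‖L‖) (hL1 : ‖L‖ ≤ 1)
    (g : G → EReal) (hg : ProxComp.IsProper g)
    (hcam : (ProxComp.contAffineMinorants g).Nonempty)
    (γ : ℝ) (hγ : 0 < γ) :
    -- the infimal postcomposition of the biconjugate is below the proximal composition
    ProxComp.infPostcomp (ContinuousLinearMap.adjoint L)
        (ProxComp.conjugate (ProxComp.conjugate g)) ≤ ProxComp.proxComp L γ g ∧
    -- bounds on the proximal cocomposition
    (ProxComp.moreauEnvelope (ProxComp.conjugate (ProxComp.conjugate g)) γ ∘ L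
        ≤ ProxComp.proxCocomp L γ g ∧
      ProxComp.proxCocomp L γ g ≤ ProxComp.conjugate (ProxComp.conjugate g) ∘ L) ∧
    -- the cocomposition is below the composition
    ProxComp.proxCocomp L γ g ≤ ProxComp.proxComp L γ g ∧
    -- isometries
    ((ContinuousLinearMap.adjoint L) ∘L L = ContinuousLinearMap.id ℝ H →
      ProxComp.proxComp L γ g = ProxComp.proxCocomp L γ g) ∧
    -- coisometries
    (L ∘L (ContinuousLinearMap.adjoint L) = ContinuousLinearMap.id ℝ G →
      ProxComp.proxComp L γ g = ProxComp.infPostcomp (ContinuousLinearMap.adjoint L)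
          (ProxComp.conjugate (ProxComp.conjugate g)) ∧
      ProxComp.ExactInfPostcomp (ContinuousLinearMap.adjoint L)
          (ProxComp.conjugate (ProxComp.conjugate g)) ∧
      ProxComp.proxCocomp L γ g = ProxComp.conjugate (ProxComp.conjugate g) ∘ L) ∧
    -- invertible operators whose inverse is the adjoint
    (L.IsInvertible ∧ L.inverse = ContinuousLinearMap.adjoint L →
      ProxComp.proxComp L γ g = ProxComp.infPostcomp (ContinuousLinearMap.adjoint L)
          (ProxComp.conjugate (ProxComp.conjugate g)) ∧
      ProxComp.ExactInfPostcomp (ContinuousLinearMap.adjoint L)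
          (ProxComp.conjugate (ProxComp.conjugate g)) ∧
      ProxComp.infPostcomp (ContinuousLinearMap.adjoint L)
          (ProxComp.conjugate (ProxComp.conjugate g))
        = ProxComp.conjugate (ProxComp.conjugate g) ∘ L ∧
      ProxComp.conjugate (ProxComp.conjugate g) ∘ L = ProxComp.proxCocomp L γ g) := by
  obtain ⟨⟨x₀, hx₀⟩, hbot⟩ := hg
  obtain ⟨h, hh⟩ := hcam
  obtain ⟨z₀, s₀, hz₀⟩ := ProxComp.exists_conjugate_le_of_contAffineMinorant hh
  obtain ⟨r₀, hr₀⟩ : ∃ r₀ : ℝ, g x₀ ≤ r₀ := ⟨_, EReal.le_coe_toReal (ne_of_lt hx₀)⟩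
  have hi := ProxComp.infPostcomp_le_proxComp hL1 hγ hr₀ hz₀
  have hii := ProxComp.proxCocomp_le_biconjugate_comp hL1 hγ hr₀ hz₀
  have hco : L ∘L (ContinuousLinearMap.adjoint L) = ContinuousLinearMap.id ℝ G →
      ProxComp.proxComp L γ g = ProxComp.infPostcomp (ContinuousLinearMap.adjoint L)
          (ProxComp.conjugate (ProxComp.conjugate g)) ∧
      ProxComp.ExactInfPostcomp (ContinuousLinearMap.adjoint L)
          (ProxComp.conjugate (ProxComp.conjugate g)) ∧
      ProxComp.proxCocomp L γ g = ProxComp.conjugate (ProxComp.conjugate g) ∘ L := fun hL =>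
    ⟨le_antisymm (ProxComp.proxComp_le_infPostcomp_of_coisometry hγ g hL) hi,
      ProxComp.exactInfPostcomp_of_injective
        (Function.LeftInverse.injective (g := L) (DFunLike.congr_fun hL))
        (ProxComp.conjugate_ne_bot hz₀),
      le_antisymm hii (ProxComp.biconjugate_comp_le_proxCocomp_of_coisometry hγ g hL)⟩
  have hiii := ProxComp.proxCocomp_le_proxComp hL1 hγ hr₀ hz₀
  refine ⟨hi, ⟨ProxComp.moreauEnvelope_comp_le_proxCocomp hγ hr₀ hz₀, hii⟩, hiii,
    fun hL => le_antisymm (ProxComp.proxComp_le_proxCocomp_of_isometry hγ g hL) hiii, hco, ?_⟩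
  rintro ⟨hinv, hadj⟩
  have hLA : L ∘L (ContinuousLinearMap.adjoint L) = ContinuousLinearMap.id ℝ G := by
    rw [← hadj, hinv.self_comp_inverse]
  have hAL : (ContinuousLinearMap.adjoint L) ∘L L = ContinuousLinearMap.id ℝ H := by
    rw [← hadj, hinv.inverse_comp_self]
  obtain ⟨h1, h2, h3⟩ := hco hLA
  refine ⟨h1, h2, funext fun x => ?_, h3.symm⟩
  have hx : ContinuousLinearMap.adjoint L (L x) = x := DFunLike.congr_fun hAL x
  conv_lhs => rw [← hx]
  exact ProxComp.infPostcomp_apply_of_injective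
    (Function.LeftInverse.injective (g := L) (DFunLike.congr_fun hLA)) _ _
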